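/- **Proposition 4.2 (metabelian Zassenhaus formula).** Let $K$ be a field of characteristic $0$, let $L$ be the free Lie algebra over $K$ generated by $X,Y$, graded by $\deg X=\deg Y=1$, and let $\bar L=L/[[L,L],[L,L]]$ be the free metabelian Lie algebra; write $X,Y$ also for the images of the generators in $\bar L$, and $x=\mathrm{ad}\,X$, $y=\mathrm{ad}\,Y$ for the adjoint operators. For $n\ge 2$ let $\bar C_n\in\bar L$ be homogeneous Lie elements of degree $n$, that is, linear combinations of commutators of length $n$ in $X,Y$. Then the expression, computed in the field of fractions of the ring $K[[x,y]]$ of commutative formal power series, $$h(x,y)=\frac{1}{x+y}\cdot\frac{e^{-y}-1}{y}\cdot\left(1+\frac{e^{-x}-1}{x}\cdot\frac{y}{e^{y}-1}\right)$$ is a genuine power series $h(x,y)=\sum_{k,l\ge0}h_{kl}x^ky^l\in K[[x,y]]$, and the elements $\bar C_n$ satisfy the metabelian Zassenhaus equation $$e^{X+Y}=e^Xe^Ye^{\bar C_2}e^{\bar C_3}e^{\bar C_4}\cdots$$ in the graded completion of the universal enveloping algebra of $\bar L$ if and only if $$\sum_{n=2}^{\infty}\bar C_n=h(x,y)[X,Y]=\sum_{k,l\ge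 0}h_{kl}\,x^ky^l[X,Y]$$ in the graded completion of $\bar L$. In particular, the equation has exactly one solution $(\bar C_n)_{n\ge2}$ in homogeneous Lie elements. -/

import Mathlib

noncomputable section

namespace MetabelianZassenhaus

section LieAlgebraWithTwoGenerators

attribute [local instance 100] LieRing.ofAssociativeRing

variable (K : Type*) [Field K] {g : Type*} [LieRing g] [LieAlgebra K g]

/-- `IsCommutator X Y n a`: the element `a` is an iterated commutator of length `n` in the letters
`X`, `Y`, with an arbitrary bracketing. -/
inductive IsCommutator (X Y : g) : ℕ → g → Prop
  | left : IsCommutator X Y 1 X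
  | right : IsCommutator X Y 1 Y
  | bracket {m n : ℕ} {a b : g} : IsCommutator X Y m a → IsCommutator X Y n b →
      IsCommutator X Y (m + n) ⁅a, b⁆

/-- The homogeneous Lie elements of degree `n`: linear combinations of commutators of length `n`
in `X`, `Y`. -/
def homogeneousLie (X Y : g) (n : ℕ) : Submodule K g :=
  Submodule.span K {a | IsCommutator X Y n a}

/-- The graded completion of the Lie algebra generated by `X`, `Y`: infinite series
`A 0 + A 1 + A 2 + ⋯` whose term `A n` is a homogeneous Lie element of degree `n`.
(There are no commutators of length `0`, so `A 0 = 0`.) -/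
abbrev LieCompletion (X Y : g) : Type _ := (n : ℕ) → homogeneousLie K X Y n

/-- A homogeneous Lie element of degree `n` as a series with a single term. -/
def LieCompletion.single {X Y : g} (n : ℕ) (a : homogeneousLie K X Y n) :
    LieCompletion K X Y :=
  Pi.single n a

/-- `X` as a homogeneous Lie element of degree `1`. -/
def genX (X Y : g) : homogeneousLie K X Y 1 :=
  ⟨X, Submodule.subset_span IsCommutator.left⟩

/-- `Y` as a homogeneous Lie element of degree `1`. -/
def genY (X Y : g) : homogeneousLie K X Y 1 :=
  ⟨Y, Submodule.subset_span IsCommutator.right⟩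

/-- `[X, Y]` as a homogeneous Lie element of degree `2`. -/
def genXY (X Y : g) : homogeneousLie K X Y 2 :=
  ⟨⁅X, Y⁆, Submodule.subset_span (IsCommutator.bracket IsCommutator.left IsCommutator.right)⟩

theorem lie_left_mem (X Y : g) {n : ℕ} {a : g} (ha : a ∈ homogeneousLie K X Y n) :
    ⁅X, a⁆ ∈ homogeneousLie K X Y (1 + n) := by
  have h : homogeneousLie K X Y n ≤
      (homogeneousLie K X Y (1 + n)).comap (LieAlgebra.ad K g X : g →ₗ[K] g) :=
    Submodule.span_le.2 fun b hb =>
      Submodule.subset_span (IsCommutator.bracket IsCommutator.left hb)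
  exact h ha

theorem lie_right_mem (X Y : g) {n : ℕ} {a : g} (ha : a ∈ homogeneousLie K X Y n) :
    ⁅Y, a⁆ ∈ homogeneousLie K X Y (1 + n) := by
  have h : homogeneousLie K X Y n ≤
      (homogeneousLie K X Y (1 + n)).comap (LieAlgebra.ad K g Y : g →ₗ[K] g) :=
    Submodule.span_le.2 fun b hb =>
      Submodule.subset_span (IsCommutator.bracket IsCommutator.right hb)
  exact h ha

theorem ad_pow_mem (X Y : g) (k l : ℕ) {n : ℕ} {a : g} (ha : a ∈ homogeneousLie K X Y n) :
    ((LieAlgebra.ad K g X) ^ k * (LieAlgebra.ad K g Y) ^ l : Module.End K g) a ∈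
      homogeneousLie K X Y (k + l + n) := by
  rw [Module.End.mul_apply]
  have hl : ((LieAlgebra.ad K g Y) ^ l : Module.End K g) a ∈ homogeneousLie K X Y (l + n) := by
    induction l with
    | zero => simpa using ha
    | succ l ih =>
      rw [pow_succ', Module.End.mul_apply]
      have := lie_right_mem K X Y ih
      rwa [show 1 + (l + n) = l + 1 + n by omega] at this
  induction k with
  | zero => simpa using hl
  | succ k ih =>
    rw [pow_succ', Module.End.mul_apply]
    have := lie_left_mem K X Y ih
    rwa [show 1 + (k + l + n) = k + 1 + l + n by omega] at this

/-- The action `f(x, y) A` of a commutative power series `f = ∑ f_{kl} x^k y^l` on a series `A` of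
the graded completion, where `x = ad X`, `y = ad Y`: its term of degree `n` is
`∑_{k + l + m = n} f_{kl} (ad X)^k (ad Y)^l A_m`.  The variables `x`, `y` are indexed by `0`, `1`. -/
def seriesAct {X Y : g} (f : MvPowerSeries (Fin 2) K) (A : LieCompletion K X Y) :
    LieCompletion K X Y := fun n =>
  ⟨∑ p ∈ Finset.HasAntidiagonal.antidiagonal n, ∑ q ∈ Finset.HasAntidiagonal.antidiagonal p.1,
      MvPowerSeries.coeff (Finsupp.single 0 q.1 + Finsupp.single 1 q.2) f •
        ((LieAlgebra.ad K g X) ^ q.1 * (LieAlgebra.ad K g Y) ^ q.2 : Module.End K g)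
          (A p.2 : g), by
    refine Submodule.sum_mem _ fun p hp => Submodule.sum_mem _ fun q hq =>
      Submodule.smul_mem _ _ ?_
    have h := ad_pow_mem K X Y q.1 q.2 (A p.2).2
    rwa [Finset.HasAntidiagonal.mem_antidiagonal.1 hq, Finset.HasAntidiagonal.mem_antidiagonal.1 hp] at h⟩

/-- The universal enveloping algebra. -/
local notation "𝒰" => UniversalEnvelopingAlgebra K g

/-- The elements of degree `n` of the universal enveloping algebra: linear combinations of
associative words of length `n` in `X`, `Y`. -/
def homogeneousEnv (X Y : g) (n : ℕ) : Submodule K 𝒰 :=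
  Submodule.span K {UniversalEnvelopingAlgebra.ι K X, UniversalEnvelopingAlgebra.ι K Y} ^ n

/-- The graded completion of the universal enveloping algebra: infinite series
`u 0 + u 1 + u 2 + ⋯` with `u n` homogeneous of degree `n`, with the Cauchy product.  Such a series
is written as the power series `∑ u_n t^n` in an auxiliary variable `t` that records the degree. -/
def EnvCompletion (X Y : g) : Subalgebra K (PowerSeries 𝒰) where
  carrier := {f | ∀ n, PowerSeries.coeff n f ∈ homogeneousEnv K X Y n}
  mul_mem' {a b} ha hb n := by
    rw [PowerSeries.coeff_mul]
    refine Submodule.sum_mem _ fun p hp => ?_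
    have h := Submodule.mul_mem_mul (ha p.1) (hb p.2)
    rwa [homogeneousEnv, homogeneousEnv, ← pow_add, Finset.HasAntidiagonal.mem_antidiagonal.1 hp] at h
  add_mem' {a b} ha hb n := by
    rw [map_add]
    exact Submodule.add_mem _ (ha n) (hb n)
  algebraMap_mem' r n := by
    rw [PowerSeries.algebraMap_apply, PowerSeries.coeff_C]
    split_ifs with h
    · subst h
      rw [homogeneousEnv, pow_zero]
      exact Submodule.mem_one.2 ⟨r, rfl⟩
    · exact Submodule.zero_mem _

theorem ι_mem_homogeneousEnv (X Y : g) {n : ℕ} {a : g} (ha : a ∈ homogeneousLie K X Y n) :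
    UniversalEnvelopingAlgebra.ι K a ∈ homogeneousEnv K X Y n := by
  have h : homogeneousLie K X Y n ≤ (homogeneousEnv K X Y n).comap
      (UniversalEnvelopingAlgebra.ι K : g →ₗ⁅K⁆ 𝒰).toLinearMap := by
    refine Submodule.span_le.2 fun b hb => ?_
    have hb' : IsCommutator X Y n b := hb
    change UniversalEnvelopingAlgebra.ι K b ∈ homogeneousEnv K X Y n
    clear ha hb
    induction hb' with
    | left => simpa [homogeneousEnv] using Submodule.subset_span (by simp)
    | right => simpa [homogeneousEnv] using Submodule.subset_span (by simp)
    | @bracket m n a b ha hb iha ihb =>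
      have h1 := Submodule.mul_mem_mul iha ihb
      have h2 := Submodule.mul_mem_mul ihb iha
      rw [homogeneousEnv, homogeneousEnv, ← pow_add] at h1 h2
      rw [add_comm n m] at h2
      rw [LieHom.map_lie, LieRing.of_associative_ring_bracket]
      exact Submodule.sub_mem _ h1 h2
  exact h ha

/-- The canonical map from the graded completion of the Lie algebra to the graded completion of its
universal enveloping algebra. -/
def toEnv {X Y : g} (A : LieCompletion K X Y) : EnvCompletion K X Y :=
  ⟨PowerSeries.mk fun n => UniversalEnvelopingAlgebra.ι K (A n : g), fun n => by
    rw [PowerSeries.coeff_mk]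
    exact ι_mem_homogeneousEnv K X Y (A n).2⟩

/-- The exponential `e^u = ∑_k u^k / k!` of a series `u` without term of degree `0`.  As `u^k` has
no terms of degree less than `k`, only `k ≤ n` contribute to the term of degree `n`. -/
def envExp {X Y : g} (u : EnvCompletion K X Y) : EnvCompletion K X Y :=
  ⟨PowerSeries.mk fun n => ∑ k ∈ Finset.range (n + 1),
      ((Nat.factorial k : K)⁻¹) • PowerSeries.coeff n ((u ^ k : EnvCompletion K X Y) : PowerSeries 𝒰),
    fun n => by
      rw [PowerSeries.coeff_mk]
      exact Submodule.sum_mem _ fun k _ => Submodule.smul_mem _ _ ((u ^ k).2 n)⟩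

/-- The exponential `e^A` of a series `A` of Lie elements. -/
def lieExp {X Y : g} (A : LieCompletion K X Y) : EnvCompletion K X Y :=
  envExp K (toEnv K A)

/-- `u` is the limit of the sequence `s` in the graded completion: in each degree, the terms of
`s M` and of `u` agree for all large `M`. -/
def ConvergesTo {X Y : g} (s : ℕ → EnvCompletion K X Y) (u : EnvCompletion K X Y) : Prop :=
  ∀ n : ℕ, ∀ᶠ M in Filter.atTop,
    PowerSeries.coeff n (s M : PowerSeries 𝒰) = PowerSeries.coeff n (u : PowerSeries 𝒰)

/-- The Zassenhaus equation `e^{X+Y} = e^X e^Y e^{C_2} e^{C_3} e^{C_4} ⋯`: the partial products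
`e^X e^Y e^{C_2} ⋯ e^{C_{M+1}}` converge to `e^{X+Y}`.  (The terms `C 0`, `C 1` are not used.) -/
def ZassenhausEquation (X Y : g) (C : (n : ℕ) → homogeneousLie K X Y n) : Prop :=
  ConvergesTo K
    (fun M => lieExp K (LieCompletion.single K 1 (genX K X Y)) *
      lieExp K (LieCompletion.single K 1 (genY K X Y)) *
      ((List.range M).map fun i => lieExp K (LieCompletion.single K (i + 2) (C (i + 2)))).prod)
    (lieExp K (LieCompletion.single K 1 (genX K X Y) + LieCompletion.single K 1 (genY K X Y)))

/-- The series `∑_{n ≥ 2} C_n` in the graded completion of the Lie algebra. -/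
def sumFromTwo {X Y : g} (C : (n : ℕ) → homogeneousLie K X Y n) : LieCompletion K X Y :=
  fun n => if 2 ≤ n then C n else 0

end LieAlgebraWithTwoGenerators

section FreeMetabelian

variable (K : Type*) [Field K]

/-- The ideal `[[L, L], [L, L]]` of the free Lie algebra `L` on two generators. -/
def secondDerived : LieIdeal K (FreeLieAlgebra K (Fin 2)) :=
  ⁅⁅(⊤ : LieIdeal K (FreeLieAlgebra K (Fin 2))), (⊤ : LieIdeal K (FreeLieAlgebra K (Fin 2)))⁆,
    ⁅(⊤ : LieIdeal K (FreeLieAlgebra K (Fin 2))), (⊤ : LieIdeal K (FreeLieAlgebra K (Fin 2)))⁆⁆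

/-- The free metabelian Lie algebra `L / [[L, L], [L, L]]` on two generators. -/
abbrev FreeMetabelian : Type _ := FreeLieAlgebra K (Fin 2) ⧸ secondDerived K

/-- The generator `X` of the free metabelian Lie algebra. -/
def mX : FreeMetabelian K :=
  LieSubmodule.Quotient.mk (FreeLieAlgebra.of K (0 : Fin 2))

/-- The generator `Y` of the free metabelian Lie algebra. -/
def mY : FreeMetabelian K :=
  LieSubmodule.Quotient.mk (FreeLieAlgebra.of K (1 : Fin 2))

end FreeMetabelian

section CommutativeSeries

variable (K : Type*) [Field K]

/-- The field of fractions of the ring of commutative power series `K[[x, y]]`. -/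
abbrev SeriesFractions : Type _ := FractionRing (MvPowerSeries (Fin 2) K)

/-- A power series in `x`, `y`, as an element of the field of fractions. -/
abbrev toFractions : MvPowerSeries (Fin 2) K →+* SeriesFractions K :=
  algebraMap (MvPowerSeries (Fin 2) K) (SeriesFractions K)

/-- The exponential `e^s` of a power series `s` in `x`, `y` with zero constant term. -/
def expOf [CharZero K] (s : MvPowerSeries (Fin 2) K) : MvPowerSeries (Fin 2) K :=
  (PowerSeries.exp K).subst s

/-- The formula
`1/(x+y) · (e^{-y} - 1)/y · (1 + (e^{-x} - 1)/x · y/(e^y - 1))`,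
computed in the field of fractions of `K[[x, y]]`. -/
def zassenhausFormula [CharZero K] : SeriesFractions K :=
  let sx : MvPowerSeries (Fin 2) K := MvPowerSeries.X 0
  let sy : MvPowerSeries (Fin 2) K := MvPowerSeries.X 1
  let x : SeriesFractions K := toFractions K sx
  let y : SeriesFractions K := toFractions K sy
  1 / (x + y) * ((toFractions K (expOf K (-sy)) - 1) / y) *
    (1 + (toFractions K (expOf K (-sx)) - 1) / x * (y / (toFractions K (expOf K sy) - 1)))

end CommutativeSeries

end MetabelianZassenhaus

end

/-! Apply the degree derivation D = t d/dt. If S has degree at least 2 and lies in the derived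
algebra, which is abelian, then S commutes with DS, so D e^S = (DS) e^S. Hence F = e^X e^Y e^S
satisfies DF = (X+Y)F, the equation that characterizes e^{X+Y}, as soon as moving Y to the right
through e^X e^Y turns it into Y + DS. Conjugation gives Y e^X e^Y = e^X e^Y (e^{-y} e^{-x} Y), so
the condition is e^{-y} e^{-x} Y = Y + DS.

On the derived algebra x and y commute, and x^{k+1} Y = x^k [X,Y], y Y = 0. The left side is thus Y
plus the sum of (-1)^{k+l+1}/((k+1)! l!) x^k y^l [X,Y]. Dividing each term by its degree k+l+2 gives
S = h(x,y)[X,Y] with the coefficients `zassenhausCoeff`. That these sum to the closed formula is a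
comparison of coefficients after clearing denominators (`zassenhausSeries_mul`).

Conversely, the C_n commute, so their exponentials multiply to the exponential of their sum
(`coe_prod_lieExp`). Cancelling e^X e^Y and using injectivity of the exponential determines the sum
inside the enveloping algebra. A faithful enough matrix representation (`matrixRep_adMonomial`)
brings the equality back to the Lie algebra, so no Poincaré–Birkhoff–Witt theorem is needed. -/

noncomputable section

namespace MetabelianZassenhaus

/-! ### Exponentials and the degree derivation over a noncommutative ring -/

section DegreeSeries

variable {R : Type*} [Ring R]

/-- The operator `t d/dt` on power series: it multiplies the term of degree `n` by `n`. -/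
def eulerOp (f : PowerSeries R) : PowerSeries R :=
  PowerSeries.mk fun n => n • PowerSeries.coeff n f

@[simp]
theorem coeff_eulerOp (n : ℕ) (f : PowerSeries R) :
    PowerSeries.coeff n (eulerOp f) = n • PowerSeries.coeff n f :=
  PowerSeries.coeff_mk _ _

theorem eulerOp_add (f g : PowerSeries R) : eulerOp (f + g) = eulerOp f + eulerOp g := by
  ext n; simp

theorem eulerOp_mul (f g : PowerSeries R) :
    eulerOp (f * g) = eulerOp f * g + f * eulerOp g := by
  ext n
  rw [coeff_eulerOp, map_add, PowerSeries.coeff_mul, PowerSeries.coeff_mul, PowerSeries.coeff_mul,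
    Finset.smul_sum, ← Finset.sum_add_distrib]
  refine Finset.sum_congr rfl fun p hp => ?_
  rw [coeff_eulerOp, coeff_eulerOp, ← Finset.HasAntidiagonal.mem_antidiagonal.1 hp, add_smul,
    smul_mul_assoc, mul_smul_comm]

theorem eulerOp_pow {u : PowerSeries R} (h : Commute u (eulerOp u)) (k : ℕ) :
    eulerOp (u ^ (k + 1)) = (k + 1) • (eulerOp u * u ^ k) := by
  induction k with
  | zero => simp
  | succ k ih =>
    rw [pow_succ, eulerOp_mul, ih, (h.pow_left (k + 1)).eq, smul_mul_assoc, mul_assoc, ← pow_succ,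
      add_smul (k + 1) 1, one_smul]

theorem coeff_pow_eq_zero {u : PowerSeries R} (hu : PowerSeries.coeff 0 u = 0) {n k : ℕ}
    (h : n < k) : PowerSeries.coeff n (u ^ k) = 0 := by
  induction k generalizing n with
  | zero => omega
  | succ k ih =>
    rw [pow_succ, PowerSeries.coeff_mul]
    refine Finset.sum_eq_zero fun p hp => ?_
    have hp' := Finset.HasAntidiagonal.mem_antidiagonal.1 hp
    by_cases h2 : p.2 = 0
    · rw [h2, hu, mul_zero]
    · rw [ih (by omega), zero_mul]

theorem eulerOp_eq_zero_iff (K : Type*) [Field K] [CharZero K] [Algebra K R]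
    {u : PowerSeries R} (hu : PowerSeries.coeff 0 u = 0) :
    eulerOp u = 0 ↔ u = 0 := by
  refine ⟨fun h => ?_, fun h => by ext; simp [h]⟩
  ext n
  rcases Nat.eq_zero_or_pos n with rfl | hn
  · simpa using hu
  · have h1 := congrArg (PowerSeries.coeff n) h
    rw [coeff_eulerOp, map_zero, ← Nat.cast_smul_eq_nsmul K] at h1
    rw [map_zero]
    exact (smul_eq_zero_iff_right (Nat.cast_ne_zero.2 hn.ne' : (n : K) ≠ 0)).1 h1

/-- Uniqueness of the solution of `t dF/dt = G F` with a given constant term. -/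
theorem eq_of_eulerOp_eq (K : Type*) [Field K] [CharZero K] [Algebra K R]
    {F F' G : PowerSeries R} (hG : PowerSeries.coeff 0 G = 0)
    (h : eulerOp F = G * F) (h' : eulerOp F' = G * F')
    (h0 : PowerSeries.coeff 0 F = PowerSeries.coeff 0 F') : F = F' := by
  ext n
  induction n using Nat.strong_induction_on with
  | _ n ih =>
    rcases Nat.eq_zero_or_pos n with rfl | hn
    · exact h0
    · have h1 : n • PowerSeries.coeff n F = n • PowerSeries.coeff n F' := by
        rw [← coeff_eulerOp, ← coeff_eulerOp, h, h', PowerSeries.coeff_mul, PowerSeries.coeff_mul]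
        refine Finset.sum_congr rfl fun p hp => ?_
        have hp' := Finset.HasAntidiagonal.mem_antidiagonal.1 hp
        by_cases hp1 : p.1 = 0
        · rw [hp1, hG, zero_mul, zero_mul]
        · rw [ih _ (by omega)]
      rw [← Nat.cast_smul_eq_nsmul K, ← Nat.cast_smul_eq_nsmul K] at h1
      exact smul_right_injective R (Nat.cast_ne_zero.2 hn.ne' : (n : K) ≠ 0) h1

variable (K : Type*) [Field K] [Algebra K R]

/-- The exponential of a power series without constant term, truncated in each degree to the
powers that contribute. -/
def expSeries (u : PowerSeries R) : PowerSeries R :=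
  PowerSeries.mk fun n => ∑ k ∈ Finset.range (n + 1),
    ((Nat.factorial k : K)⁻¹) • PowerSeries.coeff n (u ^ k)

/-- Powers beyond the degree contribute nothing, so all degrees up to `N` can share one range of
summation; this allows sums to be exchanged in products. -/
theorem coeff_expSeries {u : PowerSeries R} (hu : PowerSeries.coeff 0 u = 0) {n N : ℕ}
    (h : n ≤ N) : PowerSeries.coeff n (expSeries K u) = ∑ k ∈ Finset.range (N + 1),
      ((Nat.factorial k : K)⁻¹) • PowerSeries.coeff n (u ^ k) := by
  rw [expSeries, PowerSeries.coeff_mk]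
  refine Finset.sum_subset (Finset.range_mono (by omega)) fun k _ hk => ?_
  rw [coeff_pow_eq_zero hu (by simpa using hk), smul_zero]

theorem coeff_zero_expSeries (u : PowerSeries R) : PowerSeries.coeff 0 (expSeries K u) = 1 := by
  simp [expSeries]

@[simp]
theorem expSeries_zero : expSeries K (0 : PowerSeries R) = 1 := by
  ext n
  rw [expSeries, PowerSeries.coeff_mk, Finset.sum_eq_single 0] <;> simp +contextual

theorem expSeries_monomial_one (a : R) (n : ℕ) :
    PowerSeries.coeff n (expSeries K (PowerSeries.monomial 1 a)) =
      ((Nat.factorial n : K)⁻¹) • a ^ n := by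
  have h : ∀ k, PowerSeries.monomial 1 a ^ k = PowerSeries.monomial k (a ^ k) := fun k => by
    induction k with
    | zero => simp
    | succ k ih => rw [pow_succ, ih, PowerSeries.monomial_mul_monomial, pow_succ]
  rw [expSeries, PowerSeries.coeff_mk, Finset.sum_eq_single n]
  · rw [h, PowerSeries.coeff_monomial_same]
  · intro k _ hk
    rw [h, PowerSeries.coeff_monomial, if_neg (Ne.symm hk), smul_zero]
  · simp

/-- The term of degree `n` of the exponential depends only on the terms of degree at most `n`. -/
theorem coeff_expSeries_congr {u v : PowerSeries R} {n : ℕ}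
    (h : ∀ i ≤ n, PowerSeries.coeff i u = PowerSeries.coeff i v) :
    PowerSeries.coeff n (expSeries K u) = PowerSeries.coeff n (expSeries K v) := by
  have hpow : ∀ k, ∀ i ≤ n, PowerSeries.coeff i (u ^ k) = PowerSeries.coeff i (v ^ k) := by
    intro k
    induction k with
    | zero => simp
    | succ k ih =>
      intro i hi
      rw [pow_succ, pow_succ, PowerSeries.coeff_mul, PowerSeries.coeff_mul]
      refine Finset.sum_congr rfl fun p hp => ?_
      have hp' := Finset.HasAntidiagonal.mem_antidiagonal.1 hp
      rw [ih _ (by omega), h _ (by omega)]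
  rw [expSeries, expSeries, PowerSeries.coeff_mk, PowerSeries.coeff_mk]
  exact Finset.sum_congr rfl fun k _ => by rw [hpow k n le_rfl]

theorem coeff_mul_expSeries {u : PowerSeries R} (hu : PowerSeries.coeff 0 u = 0)
    (f : PowerSeries R) (n : ℕ) : PowerSeries.coeff n (f * expSeries K u) =
      ∑ k ∈ Finset.range (n + 1), ((Nat.factorial k : K)⁻¹) • PowerSeries.coeff n (f * u ^ k) := by
  have h : ∀ p ∈ Finset.HasAntidiagonal.antidiagonal n,
      PowerSeries.coeff p.1 f * PowerSeries.coeff p.2 (expSeries K u) =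
      ∑ k ∈ Finset.range (n + 1), ((Nat.factorial k : K)⁻¹) •
        (PowerSeries.coeff p.1 f * PowerSeries.coeff p.2 (u ^ k)) := fun p hp => by
    have hp' := Finset.HasAntidiagonal.mem_antidiagonal.1 hp
    rw [coeff_expSeries K hu (by omega : p.2 ≤ n), Finset.mul_sum]
    exact Finset.sum_congr rfl fun k _ => mul_smul_comm _ _ _
  rw [PowerSeries.coeff_mul, Finset.sum_congr rfl h, Finset.sum_comm]
  exact Finset.sum_congr rfl fun k _ => by rw [← Finset.smul_sum, ← PowerSeries.coeff_mul]

theorem coeff_expSeries_mul {u : PowerSeries R} (hu : PowerSeries.coeff 0 u = 0)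
    (f : PowerSeries R) (n : ℕ) : PowerSeries.coeff n (expSeries K u * f) =
      ∑ k ∈ Finset.range (n + 1), ((Nat.factorial k : K)⁻¹) • PowerSeries.coeff n (u ^ k * f) := by
  have h : ∀ p ∈ Finset.HasAntidiagonal.antidiagonal n,
      PowerSeries.coeff p.1 (expSeries K u) * PowerSeries.coeff p.2 f =
      ∑ k ∈ Finset.range (n + 1), ((Nat.factorial k : K)⁻¹) •
        (PowerSeries.coeff p.1 (u ^ k) * PowerSeries.coeff p.2 f) := fun p hp => by
    have hp' := Finset.HasAntidiagonal.mem_antidiagonal.1 hp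
    rw [coeff_expSeries K hu (by omega : p.1 ≤ n), Finset.sum_mul]
    exact Finset.sum_congr rfl fun k _ => smul_mul_assoc _ _ _
  rw [PowerSeries.coeff_mul, Finset.sum_congr rfl h, Finset.sum_comm]
  exact Finset.sum_congr rfl fun k _ => by rw [← Finset.smul_sum, ← PowerSeries.coeff_mul]

theorem commute_expSeries {u v : PowerSeries R} (hu : PowerSeries.coeff 0 u = 0)
    (h : Commute v u) : Commute v (expSeries K u) := by
  ext n
  rw [coeff_mul_expSeries K hu, coeff_expSeries_mul K hu]
  exact Finset.sum_congr rfl fun k _ => by rw [(h.pow_right k).eq]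

theorem isUnit_expSeries (u : PowerSeries R) : IsUnit (expSeries K u) := by
  rw [PowerSeries.isUnit_iff_constantCoeff, ← PowerSeries.coeff_zero_eq_constantCoeff_apply,
    coeff_zero_expSeries]
  exact isUnit_one

variable [CharZero K]

theorem eulerOp_expSeries {u : PowerSeries R} (hu : PowerSeries.coeff 0 u = 0)
    (h : Commute u (eulerOp u)) : eulerOp (expSeries K u) = eulerOp u * expSeries K u := by
  ext n
  -- One superfluous power is included, so that removing `k = 0` and shifting leaves exactly `k ≤
  -- n`.
  rw [coeff_eulerOp, coeff_expSeries K hu n.le_succ, Finset.sum_range_succ', smul_add,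
    Finset.smul_sum]
  have h0 : n • (((Nat.factorial 0 : K)⁻¹) • PowerSeries.coeff n (u ^ 0)) = 0 := by
    by_cases hn : n = 0 <;> simp [hn, PowerSeries.coeff_one]
  rw [h0, add_zero, coeff_mul_expSeries K hu]
  refine Finset.sum_congr rfl fun k _ => ?_
  rw [smul_comm, ← coeff_eulerOp, eulerOp_pow h,
    map_nsmul, ← Nat.cast_smul_eq_nsmul K, smul_smul, Nat.factorial_succ]
  congr 1
  have : ((k + 1 : ℕ) : K) ≠ 0 := Nat.cast_ne_zero.2 k.succ_ne_zero
  push_cast at this ⊢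
  have h2 : (k.factorial : K) ≠ 0 := Nat.cast_ne_zero.2 k.factorial_ne_zero
  field_simp

/-- Both sides solve DF = D(u+v) F with constant term 1; `huv` lets Dv pass to the left of e^u. -/
theorem expSeries_add {u v : PowerSeries R} (hu : PowerSeries.coeff 0 u = 0)
    (hv : PowerSeries.coeff 0 v = 0) (huu : Commute u (eulerOp u)) (hvv : Commute v (eulerOp v))
    (huv : Commute u (eulerOp v)) (hvu : Commute v (eulerOp u)) :
    expSeries K (u + v) = expSeries K u * expSeries K v := by
  refine eq_of_eulerOp_eq K (G := eulerOp (u + v)) (by rw [coeff_eulerOp, zero_smul]) ?_ ?_ ?_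
  · refine eulerOp_expSeries K (by rw [map_add, hu, hv, add_zero]) ?_
    rw [eulerOp_add]
    exact (huu.add_right huv).add_left (hvu.add_right hvv)
  · rw [eulerOp_mul, eulerOp_expSeries K hu huu, eulerOp_expSeries K hv hvv, ← mul_assoc,
      ← (commute_expSeries K hu huv.symm).eq, eulerOp_add, add_mul, mul_assoc, mul_assoc]
  · simp only [PowerSeries.coeff_mul, Finset.Nat.antidiagonal_zero, Finset.sum_singleton,
      coeff_zero_expSeries, mul_one]

/-- The exponential is injective on series without constant term that commute with their
derivatives. -/
theorem expSeries_injective {u v : PowerSeries R} (hu : PowerSeries.coeff 0 u = 0)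
    (hv : PowerSeries.coeff 0 v = 0) (huu : Commute u (eulerOp u)) (hvv : Commute v (eulerOp v))
    (h : expSeries K u = expSeries K v) : u = v := by
  -- Du is the logarithmic derivative of e^u, which is a unit.
  have h1 : eulerOp u = eulerOp v := by
    refine (isUnit_expSeries K v).mul_right_cancel ?_
    rw [← eulerOp_expSeries K hv hvv, ← h, ← eulerOp_expSeries K hu huu]
  have h2 : eulerOp (u - v) = 0 := by
    have := eulerOp_add (u - v) v
    rwa [sub_add_cancel, h1, right_eq_add] at this
  exact sub_eq_zero.1 ((eulerOp_eq_zero_iff K (by rw [map_sub, hu, hv, sub_zero])).1 h2)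

end DegreeSeries

/-! ### The closed formula as a power series in commuting variables -/

section CommutativeSeriesCoefficients

variable (K : Type*) [Field K]

/-- The coefficients `(-1)^{k+l+1} / (l! (k+1)! (k+l+2))` of the power series of Zassenhaus. -/
def zassenhausCoeff (k l : ℕ) : K :=
  (-1) ^ (k + l + 1) / (l.factorial * (k + 1).factorial * (k + l + 2))

/-- The power series with coefficients `zassenhausCoeff`. -/
def zassenhausSeries : MvPowerSeries (Fin 2) K := fun d => zassenhausCoeff K (d 0) (d 1)

variable {K}

/-- The coefficient of `x^a y^b`. -/
def coeffXY (a b : ℕ) (f : MvPowerSeries (Fin 2) K) : K :=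
  MvPowerSeries.coeff (Finsupp.single 0 a + Finsupp.single 1 b) f

theorem ext_coeffXY {f g : MvPowerSeries (Fin 2) K} (h : ∀ a b, coeffXY a b f = coeffXY a b g) :
    f = g := by
  ext d
  have hd : d = Finsupp.single 0 (d 0) + Finsupp.single 1 (d 1) := by
    ext i; fin_cases i <;> simp
  rw [hd]
  exact h _ _

@[simp]
theorem coeffXY_add (a b : ℕ) (f g : MvPowerSeries (Fin 2) K) :
    coeffXY a b (f + g) = coeffXY a b f + coeffXY a b g := map_add _ _ _

@[simp]
theorem coeffXY_sub (a b : ℕ) (f g : MvPowerSeries (Fin 2) K) :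
    coeffXY a b (f - g) = coeffXY a b f - coeffXY a b g := map_sub _ _ _

@[simp]
theorem coeffXY_succ_X_zero_mul (a b : ℕ) (f : MvPowerSeries (Fin 2) K) :
    coeffXY (a + 1) b (MvPowerSeries.X 0 * f) = coeffXY a b f := by
  rw [coeffXY, Finsupp.single_add, add_right_comm, add_comm, MvPowerSeries.X,
    MvPowerSeries.coeff_add_monomial_mul, one_mul, coeffXY]

@[simp]
theorem coeffXY_succ_X_one_mul (a b : ℕ) (f : MvPowerSeries (Fin 2) K) :
    coeffXY a (b + 1) (MvPowerSeries.X 1 * f) = coeffXY a b f := by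
  rw [coeffXY, Finsupp.single_add, ← add_assoc, add_comm, MvPowerSeries.X,
    MvPowerSeries.coeff_add_monomial_mul, one_mul, coeffXY]

@[simp]
theorem coeffXY_zero_X_zero_mul (b : ℕ) (f : MvPowerSeries (Fin 2) K) :
    coeffXY 0 b (MvPowerSeries.X 0 * f) = 0 := by
  rw [coeffXY, MvPowerSeries.X, MvPowerSeries.coeff_monomial_mul, if_neg]
  intro h
  simpa using h 0

@[simp]
theorem coeffXY_zero_X_one_mul (a : ℕ) (f : MvPowerSeries (Fin 2) K) :
    coeffXY a 0 (MvPowerSeries.X 1 * f) = 0 := by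
  rw [coeffXY, MvPowerSeries.X, MvPowerSeries.coeff_monomial_mul, if_neg]
  intro h
  simpa using h 1

theorem coeffXY_one (a b : ℕ) :
    coeffXY a b (1 : MvPowerSeries (Fin 2) K) = if a = 0 ∧ b = 0 then 1 else 0 := by
  rw [coeffXY, MvPowerSeries.coeff_one]
  congr 1
  simp [Finsupp.ext_iff]

theorem coeffXY_zassenhausSeries (a b : ℕ) :
    coeffXY a b (zassenhausSeries K) = zassenhausCoeff K a b := by
  change zassenhausCoeff K _ _ = _
  simp

variable (K) [CharZero K]

/-- Moves the sign into the one-variable series, so that coefficients can be read off from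
substitution of a plain variable. -/
theorem expOf_neg_X (s : Fin 2) : expOf K (-MvPowerSeries.X s) =
    (PowerSeries.evalNegHom (PowerSeries.exp K)).subst (MvPowerSeries.X s) := by
  rw [PowerSeries.evalNegHom, PowerSeries.rescale_eq_subst,
    PowerSeries.subst_comp_subst_apply (PowerSeries.HasSubst.smul_X' _) (PowerSeries.HasSubst.X s),
    PowerSeries.subst_smul (PowerSeries.HasSubst.X s), PowerSeries.subst_X (PowerSeries.HasSubst.X s),
    neg_one_smul, expOf]

theorem coeffXY_exp_neg_y (a b : ℕ) : coeffXY a b (expOf K (-MvPowerSeries.X 1)) =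
    if a = 0 then (-1) ^ b / (b.factorial : K) else 0 := by
  rw [expOf_neg_X, coeffXY, PowerSeries.coeff_subst_single]
  simp [PowerSeries.evalNegHom, Finsupp.ext_iff, div_eq_mul_inv]

theorem coeffXY_exp_mul_exp (a b : ℕ) :
    coeffXY a b (expOf K (-MvPowerSeries.X 0) * expOf K (-MvPowerSeries.X 1)) =
      (-1) ^ (a + b) / (a.factorial * b.factorial : K) := by
  rw [expOf_neg_X, expOf_neg_X, coeffXY, PowerSeries.coeff_subst_X_zero_subst_mul_X_one]
  simp [PowerSeries.evalNegHom, div_eq_mul_inv, pow_add]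
  ring

theorem expOf_mul_expOf_neg (s : Fin 2) :
    expOf K (MvPowerSeries.X s) * expOf K (-MvPowerSeries.X s) = 1 := by
  rw [expOf_neg_X, expOf, ← PowerSeries.subst_mul (PowerSeries.HasSubst.X s),
    PowerSeries.exp_mul_exp_neg_eq_one, ← PowerSeries.coe_substAlgHom (PowerSeries.HasSubst.X s),
    map_one]

/-- The closed formula multiplied by xy(x+y), using (e^{-y}-1)/(e^y-1) = -e^{-y}. Every term is kept
as a variable times a series, even `* 1`, so that the rules for `coeffXY` apply. -/
theorem zassenhausSeries_mul :
    MvPowerSeries.X 0 * (MvPowerSeries.X 1 * (MvPowerSeries.X 0 * zassenhausSeries K)) +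
      MvPowerSeries.X 0 * (MvPowerSeries.X 1 * (MvPowerSeries.X 1 * zassenhausSeries K)) =
    MvPowerSeries.X 0 * expOf K (-MvPowerSeries.X 1) +
      MvPowerSeries.X 1 * expOf K (-MvPowerSeries.X 1) - MvPowerSeries.X 0 * 1 -
      MvPowerSeries.X 1 * (expOf K (-MvPowerSeries.X 0) * expOf K (-MvPowerSeries.X 1)) := by
  have hf : ∀ n : ℕ, (n.factorial : K) ≠ 0 := fun n => Nat.cast_ne_zero.2 n.factorial_ne_zero
  have hs : ∀ n : ℕ, (n : K) + 1 ≠ 0 := Nat.cast_add_one_ne_zero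
  refine ext_coeffXY fun a b => ?_
  rcases a with _ | a
  · rcases b with _ | b
    · simp [-mul_one]
    · simp [coeffXY_exp_neg_y, coeffXY_exp_mul_exp, -mul_one]
  rcases b with _ | b
  · simp [coeffXY_exp_neg_y, coeffXY_one, -mul_one]
  have h1 := hf a
  have h2 := hf b
  have h3 := hs a
  have h4 := hs b
  -- At x^{a+1} y^{b+1} the left side is h_{a-1,b} + h_{a,b-1}, where a term with a negative index
  -- is absent.
  rcases a with _ | a <;> rcases b with _ | b <;>
    simp [coeffXY_exp_neg_y, coeffXY_exp_mul_exp, coeffXY_one, coeffXY_zassenhausSeries,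
      zassenhausCoeff, Nat.factorial_succ, -mul_one] at h1 h2 h3 h4 ⊢
  · have h5 : (b : K) + 2 ≠ 0 := by exact_mod_cast (b + 1).succ_ne_zero
    have h6 : (b : K) + 1 + 1 ≠ 0 := h4
    field_simp
    ring
  · have h5 : (a : K) + 2 ≠ 0 := by exact_mod_cast (a + 1).succ_ne_zero
    field_simp
    ring
  · have h5 : (a : K) + 1 + 1 + 1 ≠ 0 := by exact_mod_cast (a + 2).succ_ne_zero
    have h6 : (a : K) + (b + 1) + 2 ≠ 0 := by exact_mod_cast (a + (b + 1) + 1).succ_ne_zero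
    have h7 : (a : K) + 1 + b + 2 ≠ 0 := by exact_mod_cast (a + 1 + b + 1).succ_ne_zero
    field_simp
    ring

theorem toFractions_zassenhausSeries :
    toFractions K (zassenhausSeries K) = zassenhausFormula K := by
  have hinj : Function.Injective (toFractions K) := IsFractionRing.injective _ _
  have hne : ∀ (f : MvPowerSeries (Fin 2) K) (a b : ℕ), coeffXY a b f ≠ 0 →
      toFractions K f ≠ 0 := fun f a b hab hf => by
    rw [map_eq_zero_iff _ hinj] at hf
    exact hab (by rw [hf]; exact map_zero _)
  have hx : toFractions K (MvPowerSeries.X 0) ≠ 0 := by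
    refine hne _ 1 0 ?_
    rw [← mul_one (MvPowerSeries.X 0)]
    simp [coeffXY_one, -mul_one]
  have hy : toFractions K (MvPowerSeries.X 1) ≠ 0 := by
    refine hne _ 0 1 ?_
    rw [← mul_one (MvPowerSeries.X 1)]
    simp [coeffXY_one, -mul_one]
  have hxy : toFractions K (MvPowerSeries.X 0) + toFractions K (MvPowerSeries.X 1) ≠ 0 := by
    rw [← map_add]
    refine hne _ 1 0 ?_
    rw [← mul_one (MvPowerSeries.X 0), ← mul_one (MvPowerSeries.X 1)]
    simp [coeffXY_one, -mul_one]
  have he : toFractions K (expOf K (MvPowerSeries.X 1)) - 1 ≠ 0 := by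
    rw [← map_one (toFractions K), ← map_sub]
    refine hne _ 0 1 ?_
    rw [coeffXY_sub, coeffXY_one, coeffXY, expOf, PowerSeries.coeff_subst_single]
    simp
  have h1 := congrArg (toFractions K) (zassenhausSeries_mul K)
  have h2 := congrArg (toFractions K) (expOf_mul_expOf_neg K 1)
  simp only [map_add, map_sub, map_mul, map_one] at h1 h2
  simp only [zassenhausFormula]
  generalize toFractions K (MvPowerSeries.X 0) = x at *
  generalize toFractions K (MvPowerSeries.X 1) = y at *
  generalize toFractions K (expOf K (MvPowerSeries.X 1)) = e at *
  generalize toFractions K (expOf K (-MvPowerSeries.X 1)) = e' at *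
  generalize toFractions K (expOf K (-MvPowerSeries.X 0)) = d at *
  generalize toFractions K (zassenhausSeries K) = h at *
  have he' : e ≠ 0 := left_ne_zero_of_mul_eq_one h2
  rw [eq_inv_of_mul_eq_one_right h2] at h1 ⊢
  field_simp at h1 ⊢
  -- The factor `e - 1` is the denominator e^y - 1 of the formula, absent from `h1`.
  linear_combination (e - 1) * h1

end CommutativeSeriesCoefficients

/-! ### Conjugation by an exponential -/

section Conjugation

attribute [local instance 100] LieRing.ofAssociativeRing

variable (K : Type*) [Field K]

/-- Right multiplication by `z` is left multiplication minus `ad z`, and these two operators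
commute, so the binomial theorem applies. -/
theorem mul_pow_eq_sum {R : Type*} [Ring R] [Algebra K R] (a z : R) (n : ℕ) :
    a * z ^ n = ∑ q ∈ Finset.HasAntidiagonal.antidiagonal n,
      n.choose q.1 • (z ^ q.1 * ((-LieAlgebra.ad K R z : Module.End K R) ^ q.2) a) := by
  have hsum : LinearMap.mulRight K z = LinearMap.mulLeft K z + -LieAlgebra.ad K R z := by
    ext b
    simp [LieRing.of_associative_ring_bracket]
  have hcomm : Commute (LinearMap.mulLeft K z) (-LieAlgebra.ad K R z : Module.End K R) := by
    refine Commute.neg_right ?_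
    ext b
    simp [LieRing.of_associative_ring_bracket, mul_sub, mul_assoc]
  have h := congrArg (fun φ : Module.End K R => φ a) (hcomm.add_pow' n)
  simpa [← hsum, LinearMap.pow_mulRight, LinearMap.pow_mulLeft, LinearMap.sum_apply] using h

variable {g : Type*} [LieRing g] [LieAlgebra K g]

theorem ι_neg_ad_pow (z a : g) (n : ℕ) :
    ((-LieAlgebra.ad K (UniversalEnvelopingAlgebra K g) (UniversalEnvelopingAlgebra.ι K z) :
        Module.End K (UniversalEnvelopingAlgebra K g)) ^ n) (UniversalEnvelopingAlgebra.ι K a) =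
      UniversalEnvelopingAlgebra.ι K (((-LieAlgebra.ad K g z : Module.End K g) ^ n) a) := by
  induction n with
  | zero => simp
  | succ n ih =>
    rw [pow_succ', pow_succ', Module.End.mul_apply, Module.End.mul_apply, ih, LinearMap.neg_apply,
      LinearMap.neg_apply, LieAlgebra.ad_apply, LieAlgebra.ad_apply, map_neg, LieHom.map_lie]

/-- The action of `e^{-ad z}` on a series of elements of the Lie algebra, for `z` of degree `1`. -/
def adExp (z : g) (f : ℕ → g) (n : ℕ) : g :=
  ∑ q ∈ Finset.HasAntidiagonal.antidiagonal n,
    ((Nat.factorial q.1 : K)⁻¹) • ((-LieAlgebra.ad K g z : Module.End K g) ^ q.1) (f q.2)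

variable [CharZero K]

theorem ι_mul_pow (z a : g) (n : ℕ) :
    UniversalEnvelopingAlgebra.ι K a *
        (((Nat.factorial n : K)⁻¹) • UniversalEnvelopingAlgebra.ι K z ^ n) =
      ∑ q ∈ Finset.HasAntidiagonal.antidiagonal n,
        (((Nat.factorial q.1 : K)⁻¹) • UniversalEnvelopingAlgebra.ι K z ^ q.1) *
          UniversalEnvelopingAlgebra.ι K
            (((Nat.factorial q.2 : K)⁻¹) • ((-LieAlgebra.ad K g z : Module.End K g) ^ q.2) a) := by
  rw [mul_smul_comm, mul_pow_eq_sum K, Finset.smul_sum]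
  refine Finset.sum_congr rfl fun q hq => ?_
  rw [ι_neg_ad_pow, ← Nat.cast_smul_eq_nsmul K, smul_smul, map_smul, smul_mul_smul_comm]
  congr 1
  have hf : ∀ n : ℕ, (n.factorial : K) ≠ 0 := fun n => Nat.cast_ne_zero.2 n.factorial_ne_zero
  rw [← Finset.HasAntidiagonal.mem_antidiagonal.1 hq, Nat.choose_symm_add, Nat.add_choose, Nat.cast_div
    (Nat.factorial_mul_factorial_dvd_factorial_add _ _) (by
      rw [Nat.cast_mul]; exact mul_ne_zero (hf _) (hf _)), Nat.cast_mul]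
  have h1 := hf q.1
  have h2 := hf q.2
  have h3 := hf (q.1 + q.2)
  field_simp

/-- `A e^z = e^z (e^{-ad z} A)`. -/
theorem mul_expSeries_eq (z : g) (f : ℕ → g) :
    PowerSeries.mk (fun n => UniversalEnvelopingAlgebra.ι K (f n)) *
        expSeries K (PowerSeries.monomial 1 (UniversalEnvelopingAlgebra.ι K z)) =
      expSeries K (PowerSeries.monomial 1 (UniversalEnvelopingAlgebra.ι K z)) *
        PowerSeries.mk (fun n => UniversalEnvelopingAlgebra.ι K (adExp K z f n)) := by
  ext n
  simp only [PowerSeries.coeff_mul, PowerSeries.coeff_mk, expSeries_monomial_one, ι_mul_pow,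
    adExp, map_sum, Finset.mul_sum]
  rw [Finset.sum_sigma', Finset.sum_sigma']
  -- Both sides are sums over triples: the degree of the term of `f`, the power of `z` on the left,
  -- and the power of `-ad z`.
  refine Finset.sum_nbij' (fun s => ⟨(s.2.1, s.1.1 + s.2.2), (s.2.2, s.1.1)⟩)
    (fun s => ⟨(s.2.2, s.1.1 + s.2.1), (s.1.1, s.2.1)⟩) ?_ ?_ ?_ ?_ ?_
  · rintro ⟨⟨i, j⟩, ⟨k, l⟩⟩ h
    simp only [Finset.mem_sigma, Finset.HasAntidiagonal.mem_antidiagonal] at h ⊢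
    omega
  · rintro ⟨⟨i, j⟩, ⟨k, l⟩⟩ h
    simp only [Finset.mem_sigma, Finset.HasAntidiagonal.mem_antidiagonal] at h ⊢
    exact ⟨by omega, trivial⟩
  · rintro ⟨⟨i, j⟩, ⟨k, l⟩⟩ h
    simp only [Finset.mem_sigma, Finset.HasAntidiagonal.mem_antidiagonal] at h ⊢
    simp [h.2]
  · rintro ⟨⟨i, j⟩, ⟨k, l⟩⟩ h
    simp only [Finset.mem_sigma, Finset.HasAntidiagonal.mem_antidiagonal] at h ⊢
    simp [h.2, add_comm]
  · rintro ⟨⟨i, j⟩, ⟨k, l⟩⟩ h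
    rfl

end Conjugation

/-! ### Metabelian Lie algebras -/

section Metabelian

variable (K : Type*) [Field K] {g : Type*} [LieRing g] [LieAlgebra K g]

variable (g) in
/-- The linear span of all brackets. -/
def bracketSpan : Submodule K g := Submodule.span K {c | ∃ a b : g, ⁅a, b⁆ = c}

theorem lie_mem_bracketSpan (a b : g) : ⁅a, b⁆ ∈ bracketSpan K g :=
  Submodule.subset_span ⟨a, b, rfl⟩

/-- The element `x^k y^l [X, Y]`, where `x = ad X`, `y = ad Y`. -/
def adMonomial (X Y : g) (k l : ℕ) : g :=
  ((LieAlgebra.ad K g X) ^ k * (LieAlgebra.ad K g Y) ^ l : Module.End K g) ⁅X, Y⁆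

theorem lie_left_adMonomial (X Y : g) (k l : ℕ) :
    ⁅X, adMonomial K X Y k l⁆ = adMonomial K X Y (k + 1) l := by
  rw [adMonomial, adMonomial, pow_succ', mul_assoc, Module.End.mul_apply _ (_ * _),
    LieAlgebra.ad_apply]

theorem adMonomial_mem_bracketSpan (X Y : g) (k l : ℕ) :
    adMonomial K X Y k l ∈ bracketSpan K g := by
  rcases k with _ | k
  · rcases l with _ | l
    · exact lie_mem_bracketSpan K X Y
    · rw [adMonomial, pow_zero, one_mul, pow_succ', Module.End.mul_apply]
      exact lie_mem_bracketSpan K _ _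
  · rw [← lie_left_adMonomial]
    exact lie_mem_bracketSpan K _ _

variable (h2 : ∀ a b c d : g, ⁅⁅a, b⁆, ⁅c, d⁆⁆ = 0)
include h2

theorem lie_eq_zero_of_mem_bracketSpan {u v : g} (hu : u ∈ bracketSpan K g)
    (hv : v ∈ bracketSpan K g) : ⁅u, v⁆ = 0 := by
  induction hu, hv using Submodule.span_induction₂ with
  | mem_mem u v hu hv =>
    obtain ⟨a, b, rfl⟩ := hu
    obtain ⟨c, d, rfl⟩ := hv
    exact h2 a b c d
  | zero_left => simp
  | zero_right => simp
  | add_left _ _ _ _ _ _ h h' => rw [add_lie, h, h', add_zero]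
  | add_right _ _ _ _ _ _ h h' => rw [lie_add, h, h', add_zero]
  | smul_left _ _ _ _ _ h => rw [smul_lie, h, smul_zero]
  | smul_right _ _ _ _ _ h => rw [lie_smul, h, smul_zero]

/-- By the Jacobi identity the commutator of `ad Y` and `ad X` is the adjoint of [Y,X], which kills
all brackets. -/
theorem lie_lie_comm_of_mem_bracketSpan (X Y : g) {u : g} (hu : u ∈ bracketSpan K g) :
    ⁅Y, ⁅X, u⁆⁆ = ⁅X, ⁅Y, u⁆⁆ := by
  rw [leibniz_lie Y X u, lie_eq_zero_of_mem_bracketSpan K h2 (lie_mem_bracketSpan K Y X) hu,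
    zero_add]

theorem lie_right_adMonomial (X Y : g) (k l : ℕ) :
    ⁅Y, adMonomial K X Y k l⁆ = adMonomial K X Y k (l + 1) := by
  induction k with
  | zero => rw [adMonomial, adMonomial, pow_zero, one_mul, one_mul, pow_succ', Module.End.mul_apply,
      LieAlgebra.ad_apply]
  | succ k ih =>
    rw [← lie_left_adMonomial, lie_lie_comm_of_mem_bracketSpan K h2 X Y
      (adMonomial_mem_bracketSpan K X Y k l), ih, lie_left_adMonomial]

theorem ad_pow_adMonomial (X Y : g) (k l m : ℕ) :
    ((LieAlgebra.ad K g Y) ^ m : Module.End K g) (adMonomial K X Y k l) =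
      adMonomial K X Y k (l + m) := by
  induction m with
  | zero => simp
  | succ m ih => rw [pow_succ', Module.End.mul_apply, ih, LieAlgebra.ad_apply,
      lie_right_adMonomial K h2, add_assoc]

-- The shift of exponent here is the source of (k+1)! in the coefficients.
omit h2 in
theorem ad_pow_right (X Y : g) (k : ℕ) :
    ((LieAlgebra.ad K g X) ^ (k + 1) : Module.End K g) Y = adMonomial K X Y k 0 := by
  rw [pow_succ, Module.End.mul_apply, LieAlgebra.ad_apply, adMonomial, pow_zero, mul_one]

/-- In a metabelian Lie algebra, the homogeneous Lie elements of degree `n ≥ 2` are linear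
combinations of the elements `x^k y^l [X, Y]`. -/
theorem homogeneousLie_le_span (X Y : g) {n : ℕ} (hn : 2 ≤ n) :
    homogeneousLie K X Y n ≤
      Submodule.span K {a | ∃ k l, k + l + 2 = n ∧ adMonomial K X Y k l = a} := by
  have hB : ∀ n, Submodule.span K {a | ∃ k l, k + l + 2 = n ∧ adMonomial K X Y k l = a} ≤
      bracketSpan K g := fun n => Submodule.span_le.2 <| by
    rintro _ ⟨k, l, _, rfl⟩
    exact adMonomial_mem_bracketSpan K X Y k l
  have hX : ∀ n a, a ∈ Submodule.span K {a | ∃ k l, k + l + 2 = n ∧ adMonomial K X Y k l = a} →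
      ⁅X, a⁆ ∈ Submodule.span K {a | ∃ k l, k + l + 2 = 1 + n ∧ adMonomial K X Y k l = a} := by
    intro n a ha
    refine (Submodule.span_le (p := (Submodule.span K _).comap
      (LieAlgebra.ad K g X : g →ₗ[K] g))).2 ?_ ha
    rintro _ ⟨k, l, h, rfl⟩
    exact Submodule.subset_span ⟨k + 1, l, by omega, (lie_left_adMonomial K X Y k l).symm⟩
  have hY : ∀ n a, a ∈ Submodule.span K {a | ∃ k l, k + l + 2 = n ∧ adMonomial K X Y k l = a} →
      ⁅Y, a⁆ ∈ Submodule.span K {a | ∃ k l, k + l + 2 = 1 + n ∧ adMonomial K X Y k l = a} := by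
    intro n a ha
    refine (Submodule.span_le (p := (Submodule.span K _).comap
      (LieAlgebra.ad K g Y : g →ₗ[K] g))).2 ?_ ha
    rintro _ ⟨k, l, h, rfl⟩
    exact Submodule.subset_span ⟨k, l + 1, by omega, (lie_right_adMonomial K h2 X Y k l).symm⟩
  -- For an arbitrary bracketing, a bracket of two factors of degree at least 2 vanishes; otherwise
  -- one factor is a generator, and up to sign the bracket is `ad X` or `ad Y` applied to the other.
  have key : ∀ n a, IsCommutator X Y n a → (n = 1 ∧ (a = X ∨ a = Y)) ∨ (2 ≤ n ∧
      a ∈ Submodule.span K {a | ∃ k l, k + l + 2 = n ∧ adMonomial K X Y k l = a}) := by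
    intro n a ha
    induction ha with
    | left => simp
    | right => simp
    | @bracket m n a b _ _ iha ihb =>
      refine Or.inr ?_
      have hXY : ⁅X, Y⁆ ∈ Submodule.span K
          {a | ∃ k l, k + l + 2 = 1 + 1 ∧ adMonomial K X Y k l = a} :=
        Submodule.subset_span ⟨0, 0, rfl, rfl⟩
      rcases iha with ⟨rfl, ha⟩ | ⟨hm, ha⟩ <;> rcases ihb with ⟨rfl, hb⟩ | ⟨hn, hb⟩
      · refine ⟨le_rfl, ?_⟩
        rcases ha with rfl | rfl <;> rcases hb with rfl | rfl
        · rw [lie_self]; exact zero_mem _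
        · exact hXY
        · rw [← lie_skew]; exact neg_mem hXY
        · rw [lie_self]; exact zero_mem _
      · refine ⟨by omega, ?_⟩
        rcases ha with rfl | rfl
        · exact hX _ _ hb
        · exact hY _ _ hb
      · refine ⟨by omega, ?_⟩
        rw [← lie_skew, add_comm]
        rcases hb with rfl | rfl
        · exact neg_mem (hX _ _ ha)
        · exact neg_mem (hY _ _ ha)
      · refine ⟨by omega, ?_⟩
        rw [lie_eq_zero_of_mem_bracketSpan K h2 (hB _ ha) (hB _ hb)]
        exact zero_mem _
  refine Submodule.span_le.2 fun a ha => ?_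
  rcases key n a ha with ⟨h, _⟩ | ⟨_, h⟩
  · omega
  · exact h

theorem homogeneousLie_le_bracketSpan (X Y : g) {n : ℕ} (hn : 2 ≤ n) :
    homogeneousLie K X Y n ≤ bracketSpan K g :=
  (homogeneousLie_le_span K h2 X Y hn).trans <| Submodule.span_le.2 <| by
    rintro _ ⟨k, l, _, rfl⟩
    exact adMonomial_mem_bracketSpan K X Y k l

end Metabelian

/-! ### The Zassenhaus equation in a metabelian Lie algebra -/

section Equation

attribute [local instance 100] LieRing.ofAssociativeRing

variable (K : Type*) [Field K] {g : Type*} [LieRing g] [LieAlgebra K g]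

/-- A sequence of Lie elements as a power series over the universal enveloping algebra. -/
def lieSeries (f : ℕ → g) : PowerSeries (UniversalEnvelopingAlgebra K g) :=
  PowerSeries.mk fun n => UniversalEnvelopingAlgebra.ι K (f n)

@[simp]
theorem coeff_lieSeries (f : ℕ → g) (n : ℕ) :
    PowerSeries.coeff n (lieSeries K f) = UniversalEnvelopingAlgebra.ι K (f n) :=
  PowerSeries.coeff_mk _ _

theorem lieSeries_add (f f' : ℕ → g) :
    lieSeries K (f + f') = lieSeries K f + lieSeries K f' := by
  ext n; simp

theorem lieSeries_single_one (a : g) :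
    lieSeries K (Pi.single 1 a) = PowerSeries.monomial 1 (UniversalEnvelopingAlgebra.ι K a) := by
  ext n
  rw [coeff_lieSeries, PowerSeries.coeff_monomial]
  split_ifs with h
  · rw [h, Pi.single_eq_same]
  · rw [Pi.single_eq_of_ne h, map_zero]

theorem eulerOp_lieSeries (f : ℕ → g) :
    eulerOp (lieSeries K f) = lieSeries K fun n => n • f n := by
  ext n; simp

theorem eulerOp_monomial_one {R : Type*} [Ring R] (a : R) :
    eulerOp (PowerSeries.monomial 1 a) = PowerSeries.monomial 1 a := by
  ext n
  rw [coeff_eulerOp, PowerSeries.coeff_monomial]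
  split_ifs with h <;> simp [h]

theorem commute_lieSeries {f f' : ℕ → g} (h : ∀ i j, ⁅f i, f' j⁆ = 0) :
    Commute (lieSeries K f) (lieSeries K f') := by
  ext n
  rw [PowerSeries.coeff_mul, PowerSeries.coeff_mul, ← Finset.Nat.sum_antidiagonal_swap]
  refine Finset.sum_congr rfl fun p _ => ?_
  have h1 := congrArg (UniversalEnvelopingAlgebra.ι K) (h p.2 p.1)
  rw [LieHom.map_lie, map_zero, LieRing.of_associative_ring_bracket, sub_eq_zero] at h1
  simpa using h1

theorem coe_lieExp {X Y : g} (A : LieCompletion K X Y) :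
    (lieExp K A : PowerSeries (UniversalEnvelopingAlgebra K g)) =
      expSeries K (lieSeries K fun n => (A n : g)) :=
  rfl

theorem coe_single {X Y : g} {m : ℕ} (a : homogeneousLie K X Y m) (n : ℕ) :
    ((LieCompletion.single K m a n : homogeneousLie K X Y n) : g) =
      (Pi.single m (a : g) : ℕ → g) n := by
  by_cases h : n = m
  · subst h; simp [LieCompletion.single]
  · simp [LieCompletion.single, Pi.single_eq_of_ne h]

theorem coe_seriesAct {X Y : g} (f : MvPowerSeries (Fin 2) K) (A : LieCompletion K X Y) (n : ℕ) :
    (seriesAct K f A n : g) = ∑ p ∈ Finset.HasAntidiagonal.antidiagonal n,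
      ∑ q ∈ Finset.HasAntidiagonal.antidiagonal p.1, coeffXY q.1 q.2 f •
        ((LieAlgebra.ad K g X) ^ q.1 * (LieAlgebra.ad K g Y) ^ q.2 : Module.End K g)
          (A p.2 : g) :=
  rfl

theorem coe_seriesAct_single_zero {X Y : g} (f : MvPowerSeries (Fin 2) K) {n : ℕ} (hn : n < 2) :
    (seriesAct K f (LieCompletion.single K 2 (genXY K X Y)) n : g) = 0 := by
  rw [coe_seriesAct]
  refine Finset.sum_eq_zero fun p hp => Finset.sum_eq_zero fun q _ => ?_
  have hp' := Finset.HasAntidiagonal.mem_antidiagonal.1 hp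
  rw [coe_single, Pi.single_eq_of_ne (by omega), map_zero, smul_zero]

theorem coe_seriesAct_single_add_two {X Y : g} (f : MvPowerSeries (Fin 2) K) (n : ℕ) :
    (seriesAct K f (LieCompletion.single K 2 (genXY K X Y)) (n + 2) : g) =
      ∑ q ∈ Finset.HasAntidiagonal.antidiagonal n, coeffXY q.1 q.2 f • adMonomial K X Y q.1 q.2 := by
  rw [coe_seriesAct]
  rw [Finset.sum_eq_single (n, 2)]
  · refine Finset.sum_congr rfl fun q _ => ?_
    rw [coe_single, Pi.single_eq_same]
    rfl
  · intro p hp hne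
    refine Finset.sum_eq_zero fun q _ => ?_
    have hp' := Finset.HasAntidiagonal.mem_antidiagonal.1 hp
    rw [coe_single, Pi.single_eq_of_ne, map_zero, smul_zero]
    rintro h
    exact hne (Prod.ext (by simp only; omega) h)
  · intro h
    simp at h

theorem adExp_single_one_zero (X Y : g) : adExp K X (Pi.single 1 Y) 0 = 0 := by
  simp [adExp]

theorem adExp_single_one_succ (X Y : g) (n : ℕ) : adExp K X (Pi.single 1 Y) (n + 1) =
    ((Nat.factorial n : K)⁻¹) • ((-LieAlgebra.ad K g X : Module.End K g) ^ n) Y := by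
  rw [adExp, Finset.sum_eq_single (n, 1)]
  · rw [Pi.single_eq_same]
  · intro p hp hne
    have hp' := Finset.HasAntidiagonal.mem_antidiagonal.1 hp
    rw [Pi.single_eq_of_ne, map_zero, smul_zero]
    rintro h
    exact hne (Prod.ext (by simp only; omega) h)
  · intro h
    simp at h

theorem neg_ad_pow (X : g) (n : ℕ) : (-LieAlgebra.ad K g X : Module.End K g) ^ n =
    (-1 : K) ^ n • (LieAlgebra.ad K g X : Module.End K g) ^ n := by
  rw [← neg_one_smul K, smul_pow]

variable [CharZero K]

/-- The computation that determines h: in e^{-y} e^{-x} Y, the term x^k y^l [X,Y] has degree k+l+2,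
and the multiplier `n` on the right cancels this factor of the denominator. -/
theorem adExp_adExp (h2 : ∀ a b c d : g, ⁅⁅a, b⁆, ⁅c, d⁆⁆ = 0) (X Y : g) (n : ℕ) :
    adExp K Y (adExp K X (Pi.single 1 Y)) n = (Pi.single 1 Y : ℕ → g) n +
      n • (seriesAct K (zassenhausSeries K) (LieCompletion.single K 2 (genXY K X Y)) n : g) := by
  rcases n with _ | _ | n
  · simp [adExp]
  · rw [coe_seriesAct_single_zero K _ (by omega), adExp, Finset.Nat.sum_antidiagonal_succ']
    simp [adExp_single_one_zero, adExp_single_one_succ]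
  -- Since [Y,Y] = 0, the degree 1 term `Y` of e^{-x} Y contributes nothing in higher degree.
  · have hY : ((-LieAlgebra.ad K g Y : Module.End K g) ^ (n + 1)) Y = 0 := by
      rw [pow_succ, Module.End.mul_apply]
      simp
    rw [coe_seriesAct_single_add_two, adExp, Finset.Nat.sum_antidiagonal_succ',
      Finset.Nat.sum_antidiagonal_succ', adExp_single_one_zero, adExp_single_one_succ,
      Pi.single_eq_of_ne (by omega)]
    simp only [map_zero, smul_zero, zero_add, pow_zero, Module.End.one_apply, map_smul, hY,
      Nat.factorial_zero]
    rw [← Finset.Nat.sum_antidiagonal_swap, Finset.smul_sum]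
    refine Finset.sum_congr rfl fun q hq => ?_
    have hq' := Finset.HasAntidiagonal.mem_antidiagonal.1 hq
    simp only [Prod.fst_swap, Prod.snd_swap]
    rw [adExp_single_one_succ, map_smul, neg_ad_pow, neg_ad_pow, LinearMap.smul_apply,
      LinearMap.smul_apply, map_smul, ad_pow_right, ad_pow_adMonomial K h2, zero_add, smul_smul,
      smul_smul, smul_smul, ← Nat.cast_smul_eq_nsmul K, smul_smul, coeffXY_zassenhausSeries]
    congr 1
    rw [zassenhausCoeff, ← hq']
    have hf : ∀ n : ℕ, (n.factorial : K) ≠ 0 := fun n => Nat.cast_ne_zero.2 n.factorial_ne_zero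
    have h1 := hf q.2
    have h3 := hf (q.1 + 1)
    have h4 : (q.1 : K) + q.2 + 2 ≠ 0 := by exact_mod_cast (q.1 + q.2 + 1).succ_ne_zero
    push_cast
    have h5 : (q.1 : K) + q.2 + 1 + 1 ≠ 0 := by exact_mod_cast (q.1 + q.2 + 1).succ_ne_zero
    field_simp
    ring

/-- In a metabelian Lie algebra, `e^X e^Y e^{h(x,y)[X,Y]} = e^{X+Y}`. -/
theorem expSeries_mul_expSeries_mul_expSeries (h2 : ∀ a b c d : g, ⁅⁅a, b⁆, ⁅c, d⁆⁆ = 0)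
    (X Y : g) :
    expSeries K (lieSeries K (Pi.single 1 X)) * expSeries K (lieSeries K (Pi.single 1 Y)) *
      expSeries K (lieSeries K fun n => (seriesAct K (zassenhausSeries K)
        (LieCompletion.single K 2 (genXY K X Y)) n : g)) =
    expSeries K (lieSeries K (Pi.single 1 X + Pi.single 1 Y)) := by
  set S : ℕ → g := fun n => (seriesAct K (zassenhausSeries K)
        (LieCompletion.single K 2 (genXY K X Y)) n : g) with hS
  have hSB : ∀ n, S n ∈ bracketSpan K g := fun n => by
    by_cases hn : n < 2
    · rw [hS]
      simp only [coe_seriesAct_single_zero K _ hn, zero_mem]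
    · exact homogeneousLie_le_bracketSpan K h2 X Y (by omega) (Subtype.prop _)
  have hS0 : S 0 = 0 := coe_seriesAct_single_zero K _ (by omega)
  have heX : ∀ a : g, eulerOp (expSeries K (lieSeries K (Pi.single 1 a))) =
      lieSeries K (Pi.single 1 a) * expSeries K (lieSeries K (Pi.single 1 a)) := fun a => by
    rw [eulerOp_expSeries K (by simp) (by rw [lieSeries_single_one, eulerOp_monomial_one]),
      lieSeries_single_one, eulerOp_monomial_one]
  have hcS : Commute (lieSeries K S) (eulerOp (lieSeries K S)) := by
    rw [eulerOp_lieSeries]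
    exact commute_lieSeries K fun i j => lie_eq_zero_of_mem_bracketSpan K h2 (hSB i)
      (Submodule.smul_of_tower_mem _ _ (hSB j))
  have heS : eulerOp (expSeries K (lieSeries K S)) =
      eulerOp (lieSeries K S) * expSeries K (lieSeries K S) :=
    eulerOp_expSeries K (by simp [hS0]) hcS
  -- Y passes through e^X, then through e^Y; `adExp_adExp` identifies the result as Y + DS.
  have hconj : lieSeries K (Pi.single 1 Y) * expSeries K (lieSeries K (Pi.single 1 X)) *
      expSeries K (lieSeries K (Pi.single 1 Y)) = expSeries K (lieSeries K (Pi.single 1 X)) *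
        expSeries K (lieSeries K (Pi.single 1 Y)) *
          (lieSeries K (Pi.single 1 Y) + eulerOp (lieSeries K S)) := by
    have h1 : lieSeries K (Pi.single 1 Y) * expSeries K (lieSeries K (Pi.single 1 X)) =
        expSeries K (lieSeries K (Pi.single 1 X)) * lieSeries K (adExp K X (Pi.single 1 Y)) := by
      rw [lieSeries_single_one K X]
      exact mul_expSeries_eq K X (Pi.single 1 Y)
    have h3 : lieSeries K (adExp K X (Pi.single 1 Y)) * expSeries K (lieSeries K (Pi.single 1 Y)) =
        expSeries K (lieSeries K (Pi.single 1 Y)) *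
          lieSeries K (adExp K Y (adExp K X (Pi.single 1 Y))) := by
      rw [lieSeries_single_one K Y]
      exact mul_expSeries_eq K Y (adExp K X (Pi.single 1 Y))
    rw [h1, mul_assoc, h3, ← mul_assoc, eulerOp_lieSeries, ← lieSeries_add]
    congr 2
    exact funext (adExp_adExp K h2 X Y)
  have hcY : Commute (lieSeries K (Pi.single 1 Y)) (expSeries K (lieSeries K (Pi.single 1 Y))) :=
    commute_expSeries K (by simp) (Commute.refl _)
  have hadd : eulerOp (lieSeries K (Pi.single 1 X + Pi.single 1 Y)) =
      lieSeries K (Pi.single 1 X) + lieSeries K (Pi.single 1 Y) := by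
    rw [lieSeries_add, lieSeries_single_one, lieSeries_single_one, eulerOp_add,
      eulerOp_monomial_one, eulerOp_monomial_one]
  -- Both sides solve DF = (X+Y)F with constant term 1.
  refine eq_of_eulerOp_eq K (G := lieSeries K (Pi.single 1 X) + lieSeries K (Pi.single 1 Y))
    (by rw [← lieSeries_add]; simp) ?_ ?_ ?_
  · have hY : lieSeries K (Pi.single 1 Y) * (expSeries K (lieSeries K (Pi.single 1 X)) *
        expSeries K (lieSeries K (Pi.single 1 Y)) * expSeries K (lieSeries K S)) =
        expSeries K (lieSeries K (Pi.single 1 X)) * (lieSeries K (Pi.single 1 Y) *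
          expSeries K (lieSeries K (Pi.single 1 Y))) * expSeries K (lieSeries K S) +
        expSeries K (lieSeries K (Pi.single 1 X)) * expSeries K (lieSeries K (Pi.single 1 Y)) *
          (eulerOp (lieSeries K S) * expSeries K (lieSeries K S)) := by
      rw [← mul_assoc, ← mul_assoc, hconj, hcY.eq]
      simp only [mul_add, add_mul, mul_assoc]
    rw [eulerOp_mul, eulerOp_mul, heX, heX, heS, add_mul (lieSeries K _) (lieSeries K _), hY]
    simp only [add_mul, mul_assoc, add_assoc]
  · rw [eulerOp_expSeries K (by simp) (by
      rw [hadd, lieSeries_add]), hadd]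
  · simp only [PowerSeries.coeff_mul, Finset.Nat.antidiagonal_zero, Finset.sum_singleton,
      coeff_zero_expSeries, mul_one]

/-- All `C n` with `n ≥ 2` lie in the abelian derived algebra, so multiplying exponentials adds
exponents. -/
theorem coe_prod_lieExp (h2 : ∀ a b c d : g, ⁅⁅a, b⁆, ⁅c, d⁆⁆ = 0) {X Y : g}
    (C : (n : ℕ) → homogeneousLie K X Y n) (M : ℕ) :
    ((((List.range M).map fun i => lieExp K (LieCompletion.single K (i + 2) (C (i + 2)))).prod :
      EnvCompletion K X Y) : PowerSeries (UniversalEnvelopingAlgebra K g)) =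
    expSeries K (lieSeries K fun n => if 2 ≤ n ∧ n < M + 2 then (C n : g) else 0) := by
  have hC : ∀ n, 2 ≤ n → (C n : g) ∈ bracketSpan K g := fun n hn =>
    homogeneousLie_le_bracketSpan K h2 X Y hn (C n).2
  induction M with
  | zero =>
    have h0 : (lieSeries K fun n => if 2 ≤ n ∧ n < 0 + 2 then (C n : g) else 0) = 0 := by
      ext n
      rw [coeff_lieSeries, if_neg (by omega), map_zero, map_zero]
    rw [h0, expSeries_zero]
    rfl
  | succ M ih =>
    have hsplit : (fun n => if 2 ≤ n ∧ n < M + 1 + 2 then (C n : g) else 0) =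
        (fun n => if 2 ≤ n ∧ n < M + 2 then (C n : g) else 0) +
          fun n => (LieCompletion.single K (M + 2) (C (M + 2)) n : g) := by
      funext n
      rw [Pi.add_apply, coe_single]
      by_cases hn : n = M + 2
      · subst hn
        rw [if_pos (by omega), if_neg (by omega), Pi.single_eq_same, zero_add]
      · rw [Pi.single_eq_of_ne hn, add_zero]
        exact if_congr (by omega) rfl rfl
    have hmem1 : ∀ n, (if 2 ≤ n ∧ n < M + 2 then (C n : g) else 0) ∈ bracketSpan K g := fun n => by
      split_ifs with hn
      · exact hC n hn.1
      · exact zero_mem _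
    have hmem2 : ∀ n, (LieCompletion.single K (M + 2) (C (M + 2)) n : g) ∈ bracketSpan K g :=
      fun n => by
        rw [coe_single]
        by_cases hn : n = M + 2
        · subst hn
          rw [Pi.single_eq_same]
          exact hC _ (by omega)
        · rw [Pi.single_eq_of_ne hn]
          exact zero_mem _
    have hcomm : ∀ f f' : ℕ → g, (∀ n, f n ∈ bracketSpan K g) → (∀ n, f' n ∈ bracketSpan K g) →
        Commute (lieSeries K f) (eulerOp (lieSeries K f')) := fun f f' hf hf' => by
      rw [eulerOp_lieSeries]
      exact commute_lieSeries K fun i j => lie_eq_zero_of_mem_bracketSpan K h2 (hf i)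
        (Submodule.smul_of_tower_mem _ _ (hf' j))
    rw [List.range_succ, List.map_append, List.prod_append, List.map_singleton,
      List.prod_singleton, Subalgebra.coe_mul, ih, coe_lieExp, hsplit, lieSeries_add,
      expSeries_add K (by simp) (by simp [coe_single]) (hcomm _ _ hmem1 hmem1)
        (hcomm _ _ hmem2 hmem2) (hcomm _ _ hmem1 hmem2) (hcomm _ _ hmem2 hmem1)]

/-- The limit disappears: a factor e^{C_m} affects only degrees at least m, so each coefficient of
the partial products is eventually constant. -/
theorem zassenhausEquation_iff (h2 : ∀ a b c d : g, ⁅⁅a, b⁆, ⁅c, d⁆⁆ = 0) {X Y : g}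
    (C : (n : ℕ) → homogeneousLie K X Y n) : ZassenhausEquation K X Y C ↔
    expSeries K (lieSeries K (Pi.single 1 X)) * expSeries K (lieSeries K (Pi.single 1 Y)) *
      expSeries K (lieSeries K fun n => (sumFromTwo K C n : g)) =
    expSeries K (lieSeries K (Pi.single 1 X + Pi.single 1 Y)) := by
  have hX : (fun n => (LieCompletion.single K 1 (genX K X Y) n : g)) = Pi.single 1 X :=
    funext fun n => coe_single K _ n
  have hY : (fun n => (LieCompletion.single K 1 (genY K X Y) n : g)) = Pi.single 1 Y :=
    funext fun n => coe_single K _ n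
  have hXY : (fun n => ((LieCompletion.single K 1 (genX K X Y) +
      LieCompletion.single K 1 (genY K X Y)) n : g)) = Pi.single 1 X + Pi.single 1 Y := by
    rw [← hX, ← hY]; rfl
  have hcoeff : ∀ n M, n ≤ M → PowerSeries.coeff n
      (expSeries K (lieSeries K (Pi.single 1 X)) * expSeries K (lieSeries K (Pi.single 1 Y)) *
        expSeries K (lieSeries K fun n => if 2 ≤ n ∧ n < M + 2 then (C n : g) else 0)) =
      PowerSeries.coeff n
        (expSeries K (lieSeries K (Pi.single 1 X)) * expSeries K (lieSeries K (Pi.single 1 Y)) *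
          expSeries K (lieSeries K fun n => (sumFromTwo K C n : g))) := by
    intro n M hM
    rw [PowerSeries.coeff_mul, PowerSeries.coeff_mul]
    refine Finset.sum_congr rfl fun p hp => ?_
    have hp' := Finset.HasAntidiagonal.mem_antidiagonal.1 hp
    congr 1
    refine coeff_expSeries_congr K fun i hi => ?_
    rw [coeff_lieSeries, coeff_lieSeries, sumFromTwo]
    congr 1
    by_cases h : 2 ≤ i
    · rw [if_pos (by omega), if_pos h]
    · rw [if_neg (by omega), if_neg h, ZeroMemClass.coe_zero]
  simp only [ZassenhausEquation, ConvergesTo, Subalgebra.coe_mul, coe_prod_lieExp K h2, coe_lieExp,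
    hX, hY, hXY]
  constructor
  · intro h
    ext n
    obtain ⟨M, hM⟩ := Filter.eventually_atTop.1 (h n)
    rw [← hM (max M n) (le_max_left _ _), hcoeff n _ (le_max_right _ _)]
  · intro h n
    filter_upwards [Filter.eventually_ge_atTop n] with M hM
    rw [hcoeff n M hM, h]

/-- The solutions of the Zassenhaus equation in a metabelian Lie algebra whose homogeneous elements
of degree at least `2` embed into the universal enveloping algebra. -/
theorem zassenhausEquation_iff_sumFromTwo_eq (h2 : ∀ a b c d : g, ⁅⁅a, b⁆, ⁅c, d⁆⁆ = 0) {X Y : g}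
    (hι : ∀ n, 2 ≤ n → ∀ a ∈ homogeneousLie K X Y n, UniversalEnvelopingAlgebra.ι K a = 0 → a = 0)
    (C : (n : ℕ) → homogeneousLie K X Y n) : ZassenhausEquation K X Y C ↔
    sumFromTwo K C = seriesAct K (zassenhausSeries K)
      (LieCompletion.single K 2 (genXY K X Y)) := by
  rw [zassenhausEquation_iff K h2, ← expSeries_mul_expSeries_mul_expSeries K h2]
  refine ⟨fun h => ?_, fun h => by rw [h]⟩
  have hlow : ∀ n < 2, (sumFromTwo K C n : g) = 0 := fun n hn => by
    rw [sumFromTwo, if_neg (by omega), ZeroMemClass.coe_zero]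
  have hcomm : ∀ A : LieCompletion K X Y, (∀ n < 2, (A n : g) = 0) →
      Commute (lieSeries K fun n => (A n : g)) (eulerOp (lieSeries K fun n => (A n : g))) := by
    intro A hA
    have hB : ∀ n, (A n : g) ∈ bracketSpan K g := fun n => by
      by_cases hn : n < 2
      · rw [hA n hn]; exact zero_mem _
      · exact homogeneousLie_le_bracketSpan K h2 X Y (by omega) (A n).2
    rw [eulerOp_lieSeries]
    exact commute_lieSeries K fun i j => lie_eq_zero_of_mem_bracketSpan K h2 (hB i)
        (Submodule.smul_of_tower_mem _ _ (hB j))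
  have hact : ∀ n < 2, (seriesAct K (zassenhausSeries K)
      (LieCompletion.single K 2 (genXY K X Y)) n : g) = 0 :=
    fun n hn => coe_seriesAct_single_zero K _ hn
  have h1 := ((isUnit_expSeries K _).mul (isUnit_expSeries K _)).mul_left_cancel h
  have h3 := expSeries_injective K (by simp [hlow 0]) (by simp [hact 0]) (hcomm _ hlow)
    (hcomm _ hact) h1
  funext n
  by_cases hn : n < 2
  · exact Subtype.ext ((hlow n hn).trans (hact n hn).symm)
  -- So far the equality holds only after applying `ι`; `hι` lifts it to the Lie algebra.
  · have h4 := congrArg (PowerSeries.coeff n) h3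
    rw [coeff_lieSeries, coeff_lieSeries, ← sub_eq_zero, ← map_sub] at h4
    exact sub_eq_zero.1 (Subtype.ext (hι n (by omega) _ (Subtype.prop _) h4))

end Equation

/-! ### A matrix representation of the free metabelian Lie algebra -/

section MatrixRepresentation

attribute [local instance 100] LieRing.ofAssociativeRing

theorem freeMetabelian_lie_lie (K : Type*) [Field K] (a b c d : FreeMetabelian K) :
    ⁅⁅a, b⁆, ⁅c, d⁆⁆ = 0 := by
  obtain ⟨a, rfl⟩ := LieSubmodule.Quotient.surjective_mk' (secondDerived K) a
  obtain ⟨b, rfl⟩ := LieSubmodule.Quotient.surjective_mk' (secondDerived K) b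
  obtain ⟨c, rfl⟩ := LieSubmodule.Quotient.surjective_mk' (secondDerived K) c
  obtain ⟨d, rfl⟩ := LieSubmodule.Quotient.surjective_mk' (secondDerived K) d
  have h : ∀ x y : FreeLieAlgebra K (Fin 2),
      ⁅x, y⁆ ∈ ⁅(⊤ : LieIdeal K (FreeLieAlgebra K (Fin 2))),
        (⊤ : LieIdeal K (FreeLieAlgebra K (Fin 2)))⁆ := fun x y =>
    LieSubmodule.lie_mem_lie (LieSubmodule.mem_top x) (LieSubmodule.mem_top y)
  exact (LieSubmodule.Quotient.mk_eq_zero (N := secondDerived K)).2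
    (LieSubmodule.lie_mem_lie (h a b) (h c d))

variable {K : Type*} [Field K]

/-- A homomorphism from the free Lie algebra to a metabelian Lie algebra factors through the free
metabelian Lie algebra. -/
def liftFreeMetabelian {g : Type*} [LieRing g] [LieAlgebra K g]
    (h2 : ∀ a b c d : g, ⁅⁅a, b⁆, ⁅c, d⁆⁆ = 0) (f : FreeLieAlgebra K (Fin 2) →ₗ⁅K⁆ g) :
    FreeMetabelian K →ₗ⁅K⁆ g :=
  { (secondDerived K).toSubmodule.liftQ (f : FreeLieAlgebra K (Fin 2) →ₗ[K] g) (by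
      have hB : ∀ x ∈ ⁅(⊤ : LieIdeal K (FreeLieAlgebra K (Fin 2))),
          (⊤ : LieIdeal K (FreeLieAlgebra K (Fin 2)))⁆, f x ∈ bracketSpan K g := by
        intro x hx
        rw [← LieSubmodule.mem_toSubmodule, LieSubmodule.lieIdeal_oper_eq_linear_span'] at hx
        refine (Submodule.span_le (p := (bracketSpan K g).comap
          (f : FreeLieAlgebra K (Fin 2) →ₗ[K] g))).2 ?_ hx
        rintro _ ⟨a, _, b, _, rfl⟩
        exact Submodule.subset_span ⟨f a, f b, (f.map_lie a b).symm⟩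
      have hle : secondDerived K ≤ f.ker := by
        refine (LieSubmodule.lie_le_iff _ _ _).2 fun x hx y hy => ?_
        rw [LieHom.mem_ker, LieHom.map_lie]
        exact lie_eq_zero_of_mem_bracketSpan K h2 (hB x hx) (hB y hy)
      intro x hx
      exact LieHom.mem_ker.1 (hle hx)) with
    map_lie' := by
      intro x y
      obtain ⟨x, rfl⟩ := LieSubmodule.Quotient.surjective_mk' (secondDerived K) x
      obtain ⟨y, rfl⟩ := LieSubmodule.Quotient.surjective_mk' (secondDerived K) y
      exact f.map_lie x y }

variable (K) in
/-- The Lie algebra of `2 × 2` matrices over `K[x, y]` with vanishing second row. -/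
def topRow : LieSubalgebra K (Matrix (Fin 2) (Fin 2) (MvPolynomial (Fin 2) K)) where
  carrier := {M | ∀ j, M 1 j = 0}
  add_mem' ha hb j := by simp [ha j, hb j]
  zero_mem' j := rfl
  smul_mem' c M hM j := by simp [hM j]
  lie_mem' {M N} hM hN j := by
    simp [LieRing.of_associative_ring_bracket, Matrix.mul_apply, hM _, hN _]

/-- Polynomials commute, so a bracket has zero diagonal and is a multiple of the matrix unit E_12,
whose square is zero. -/
theorem topRow_lie_lie (a b c d : topRow K) : ⁅⁅a, b⁆, ⁅c, d⁆⁆ = 0 := by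
  have h : ∀ M N : topRow K, (⁅M, N⁆ : topRow K).1 0 0 = 0 := fun M N => by
    have hM := M.2
    have hN := N.2
    change ∀ j, M.1 1 j = 0 at hM
    change ∀ j, N.1 1 j = 0 at hN
    simp [LieRing.of_associative_ring_bracket, Matrix.mul_apply, hM _, hN _, mul_comm]
  have hab := h a b
  have hcd := h c d
  have hab1 : ∀ j, (⁅a, b⁆ : topRow K).1 1 j = 0 := (⁅a, b⁆ : topRow K).2
  have hcd1 : ∀ j, (⁅c, d⁆ : topRow K).1 1 j = 0 := (⁅c, d⁆ : topRow K).2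
  generalize ⁅a, b⁆ = u at *
  generalize ⁅c, d⁆ = v at *
  ext i j : 3
  rw [LieSubalgebra.coe_bracket, LieRing.of_associative_ring_bracket]
  fin_cases i <;> simp [Matrix.mul_apply, hab, hcd, hab1, hcd1]

variable (K) in
/-- The images of the generators under the matrix representation. -/
def genMatrix (i : Fin 2) : topRow K :=
  ⟨!![MvPolynomial.X i, if i = 1 then 1 else 0; 0, 0], fun j => by fin_cases j <;> rfl⟩

variable (K) in
/-- The representation of the free metabelian Lie algebra by `2 × 2` matrices over `K[x, y]`. -/
def matrixRep : FreeMetabelian K →ₗ⁅K⁆ Matrix (Fin 2) (Fin 2) (MvPolynomial (Fin 2) K) :=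
  (topRow K).incl.comp
    (liftFreeMetabelian topRow_lie_lie (FreeLieAlgebra.lift K (genMatrix K)))

theorem matrixRep_mX : matrixRep K (mX K) = !![MvPolynomial.X 0, 0; 0, 0] := by
  change ((FreeLieAlgebra.lift K (genMatrix K)) (FreeLieAlgebra.of K 0)).1 = _
  rw [FreeLieAlgebra.lift_of_apply]
  rfl

theorem matrixRep_mY : matrixRep K (mY K) = !![MvPolynomial.X 1, 1; 0, 0] := by
  change ((FreeLieAlgebra.lift K (genMatrix K)) (FreeLieAlgebra.of K 1)).1 = _
  rw [FreeLieAlgebra.lift_of_apply]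
  rfl

/-- [X,Y] maps to x E_12, and on multiples of E_12 the operators `ad X`, `ad Y` act as
multiplication by the variables x, y. -/
theorem matrixRep_adMonomial (k l : ℕ) : matrixRep K (adMonomial K (mX K) (mY K) k l) =
    !![0, MvPolynomial.monomial (Finsupp.single 0 (k + 1) + Finsupp.single 1 l) 1; 0, 0] := by
  induction k with
  | succ k ih =>
    rw [← lie_left_adMonomial, LieHom.map_lie, ih, matrixRep_mX,
      LieRing.of_associative_ring_bracket]
    ext1 i j
    fin_cases i <;> fin_cases j <;> simp
    rw [MvPolynomial.X, MvPolynomial.monomial_mul, ← add_assoc, one_mul,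
      add_comm (Finsupp.single 0 1)]
  | zero =>
    induction l with
    | zero =>
      simp only [adMonomial, pow_zero, one_mul, Module.End.one_apply]
      rw [LieHom.map_lie, matrixRep_mX, matrixRep_mY, LieRing.of_associative_ring_bracket]
      ext1 i j
      fin_cases i <;> fin_cases j <;> simp [MvPolynomial.X, mul_comm]
    | succ l ih =>
      rw [← lie_right_adMonomial K (freeMetabelian_lie_lie K), LieHom.map_lie, ih, matrixRep_mY,
        LieRing.of_associative_ring_bracket]
      ext1 i j
      fin_cases i <;> fin_cases j <;> simp
      rw [MvPolynomial.X, MvPolynomial.monomial_mul, add_left_comm, one_mul,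
        add_comm (Finsupp.single 1 1)]

/-- The homogeneous elements of degree at least `2` of the free metabelian Lie algebra embed into
the universal enveloping algebra. -/
theorem eq_zero_of_ι_eq_zero {n : ℕ} (hn : 2 ≤ n) {a : FreeMetabelian K}
    (ha : a ∈ homogeneousLie K (mX K) (mY K) n) (h : UniversalEnvelopingAlgebra.ι K a = 0) :
    a = 0 := by
  -- The representation extends to the enveloping algebra, so it kills whatever `ι` kills.
  have hrep : matrixRep K a = 0 := by
    rw [← UniversalEnvelopingAlgebra.lift_ι_apply K (matrixRep K) a, h, map_zero]
  have hspan : a ∈ Submodule.span K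
      (Set.range fun p : ℕ × ℕ => adMonomial K (mX K) (mY K) p.1 p.2) := by
    refine Submodule.span_mono ?_ (homogeneousLie_le_span K (freeMetabelian_lie_lie K) _ _ hn ha)
    rintro _ ⟨k, l, _, rfl⟩
    exact ⟨(k, l), rfl⟩
  obtain ⟨c, rfl⟩ := Finsupp.mem_span_range_iff_exists_finsupp.1 hspan
  have hinj : Function.Injective fun p : ℕ × ℕ =>
      (Finsupp.single 0 (p.1 + 1) + Finsupp.single 1 p.2 : Fin 2 →₀ ℕ) := fun p q hpq => by
    have h0 := DFunLike.congr_fun hpq 0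
    have h1 := DFunLike.congr_fun hpq 1
    simp at h0 h1
    exact Prod.ext h0 h1
  -- Distinct pairs (k,l) give distinct monomials x^{k+1} y^l, so the images of the spanning
  -- elements are linearly independent.
  have hli := (MvPolynomial.basisMonomials (Fin 2) K).linearIndependent.comp _ hinj
  have hc : c = 0 := by
    refine linearIndependent_iff.1 hli c ?_
    have h1 := congrArg (fun M => M 0 1) hrep
    rw [Finsupp.sum, map_sum] at h1
    simp only [map_smul, matrixRep_adMonomial, Matrix.sum_apply] at h1
    simpa [Finsupp.linearCombination_apply, Finsupp.sum] using h1
  rw [hc, Finsupp.sum_zero_index]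

end MatrixRepresentation

end MetabelianZassenhaus

end

/-- The formula is a genuine power series `h(x, y)`, and homogeneous Lie elements `C_n` of degree
`n` of the free metabelian Lie algebra solve the Zassenhaus equation if and only if
`∑_{n ≥ 2} C_n = h(x, y) [X, Y]`. -/
theorem proposition4p2 (K : Type*) [Field K] [CharZero K] :
    ∃ h : MvPowerSeries (Fin 2) K,
      MetabelianZassenhaus.toFractions K h = MetabelianZassenhaus.zassenhausFormula K ∧
      ∀ C : (n : ℕ) → MetabelianZassenhaus.homogeneousLie K
          (MetabelianZassenhaus.mX K) (MetabelianZassenhaus.mY K) n,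
        MetabelianZassenhaus.ZassenhausEquation K
            (MetabelianZassenhaus.mX K) (MetabelianZassenhaus.mY K) C ↔
          MetabelianZassenhaus.sumFromTwo K C =
            MetabelianZassenhaus.seriesAct K h
              (MetabelianZassenhaus.LieCompletion.single K 2
                (MetabelianZassenhaus.genXY K
                  (MetabelianZassenhaus.mX K) (MetabelianZassenhaus.mY K))) :=
  ⟨MetabelianZassenhaus.zassenhausSeries K, MetabelianZassenhaus.toFractions_zassenhausSeries K,
    MetabelianZassenhaus.zassenhausEquation_iff_sumFromTwo_eq K
      (MetabelianZassenhaus.freeMetabelian_lie_lie K)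
      fun _ hn _ ha h => MetabelianZassenhaus.eq_zero_of_ι_eq_zero hn ha h⟩
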